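/- Let $K$ be a field, let $n\ge 2$, and let $\mathbb X=\{p_1,\dots,p_s\}\subseteq\mathbb P^n_K$ be a set of $s$ distinct $K$-rational points, none of which lies on the hyperplane $X_0=0$; write $p_j=(1:a_{j1}:\dots:a_{jn})$. Assume that $\operatorname{char}K=0$ or $\operatorname{char}K>s$. Let $P=K[X_0,\dots,X_n]$, let $I_{\mathbb X}\subseteq P$ be the homogeneous vanishing ideal of $\mathbb X$, let $R=P/I_{\mathbb X}$, and let $x_i$ be the image of $X_i$ in $R$. Let $\operatorname{HF}_{\mathbb X}(i)=\dim_K R_i$ be the Hilbert function of $\mathbb X$, let $r_{\mathbb X}$ be its regularity index (the least $i$ from which on $\operatorname{HF}_{\mathbb X}$ agrees with the Hilbert polynomial), and let $\alpha_{\mathbb X}=\min\{i\mid (I_{\mathbb X})_i\ne 0\}$. Let $\vartheta_{\mathbb X}\subseteq R$ be the Kähler different, i.e. the initial Fitting ideal of $\Omega^1_{R/K[x_0]}$. Assume that $\mathbb X$ is in generic position, i.e. $\operatorname{HF}_{\mathbb X}(i)=\min\{s,\binom{n+i}{n}\}$ for all $i\ge 0$, that $\binom{n+\alpha_{\mathbb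 X}-1}{n}<s<\binom{n+\alpha_{\mathbb X}}{n}$, and that $r_{\mathbb X}\ge 2$. Let $F_1,\dots,F_t$ be a $K$-basis of $(I_{\mathbb X})_{\alpha_{\mathbb X}}$ and assume $t\ge n$. Let $h_1,\dots,h_\delta$, $\delta=\binom tn$, be the Jacobian determinants $\frac{\partial(F_{i_1},\dots,F_{i_n})}{\partial(X_1,\dots,X_n)}$ for $1\le i_1<\dots<i_n\le t$. Let $\mathcal A=(h_k(1,a_{j1},\dots,a_{jn}))_{j,k}\in K^{s\times\delta}$, and for $j\in\{1,\dots,s\}$ let $\mathcal A_j=(\mathcal A\mid\mathcal E_j)$, where $\mathcal E_j$ is the $j$-th standard basis column of $K^s$. For each $j$ let $\deg_{\mathbb X}(p_j)$ be the least degree of a homogeneous polynomial which does not vanish at $p_j$ but vanishes at all $p_k$ with $k\neq j$; $\mathbb X$ is called a Cayley-Bacharach scheme (CB-scheme) if $\deg_{\mathbb X}(p_j)=r_{\mathbb X}$ for all $j$. Then: 1. The images of $h_1,\dots,h_\delta$ in $R$ span the homogeneous component $(\vartheta_{\mathbb X})_{n(r_{\mathbb X}-1)}$ over $K$. 2. If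 $\operatorname{rank}(\mathcal A_j)>\operatorname{rank}(\mathcal A)$ for all $j=1,\dots,s$, then $\mathbb X$ is a CB-scheme. 3. Conversely, if $n=2$ or $(n,r_{\mathbb X})=(3,2)$, and $\mathbb X$ is a CB-scheme, then $\operatorname{rank}(\mathcal A_j)>\operatorname{rank}(\mathcal A)$ for all $j=1,\dots,s$. -/

import Mathlib

open scoped LinearAlgebra.Projectivization

noncomputable section

namespace KaehlerCB

/-- The homogeneous vanishing ideal `I_X` in `P = K[X_0, ..., X_n]` of the family of `K`-rational
points `p_1, ..., p_s` of projective `n`-space: the ideal generated by all homogeneous polynomials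
which vanish at every `p_j` (for a homogeneous polynomial this does not depend on the chosen
representative of `p_j`). -/
def vanishingIdeal {K : Type*} [Field K] {n s : ℕ} (p : Fin s → ℙ K (Fin (n + 1) → K)) :
    Ideal (MvPolynomial (Fin (n + 1)) K) :=
  Ideal.span {F | (∃ d : ℕ, F.IsHomogeneous d) ∧ ∀ j, MvPolynomial.eval (p j).rep F = 0}

/-- The homogeneous component `(I_X)_d` of the vanishing ideal, as a subspace of `P`. -/
def idealPart {K : Type*} [Field K] {n s : ℕ} (p : Fin s → ℙ K (Fin (n + 1) → K)) (d : ℕ) :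
    Submodule K (MvPolynomial (Fin (n + 1)) K) :=
  (vanishingIdeal p).restrictScalars K ⊓ MvPolynomial.homogeneousSubmodule (Fin (n + 1)) K d

/-- The initial degree `α_X`, the least `i` with `(I_X)_i ≠ 0`. -/
def initialDegree {K : Type*} [Field K] {n s : ℕ} (p : Fin s → ℙ K (Fin (n + 1) → K)) : ℕ :=
  sInf {i : ℕ | idealPart p i ≠ ⊥}

/-- The homogeneous coordinate ring `R = P / I_X`. -/
abbrev CoordRing {K : Type*} [Field K] {n s : ℕ} (p : Fin s → ℙ K (Fin (n + 1) → K)) : Type _ :=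
  MvPolynomial (Fin (n + 1)) K ⧸ vanishingIdeal p

/-- The homogeneous component `R_d` of the coordinate ring. -/
def ringPart {K : Type*} [Field K] {n s : ℕ} (p : Fin s → ℙ K (Fin (n + 1) → K)) (d : ℕ) :
    Submodule K (CoordRing p) :=
  (MvPolynomial.homogeneousSubmodule (Fin (n + 1)) K d).map
    (Ideal.Quotient.mkₐ K (vanishingIdeal p)).toLinearMap

/-- The Hilbert function of `X` (in non-negative degrees; it vanishes in negative degrees). -/
def hilbertFunction {K : Type*} [Field K] {n s : ℕ} (p : Fin s → ℙ K (Fin (n + 1) → K))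
    (i : ℕ) : ℕ :=
  Module.finrank K (ringPart p i)

/-- The regularity index `r_X`: the least `i` such that the Hilbert function agrees with a
polynomial in all degrees `≥ i`.  Such a polynomial is necessarily the Hilbert polynomial.
For a non-empty `X` the index is never negative, since the Hilbert polynomial is then a non-zero
constant while the Hilbert function vanishes in negative degrees. -/
def regularityIndex {K : Type*} [Field K] {n s : ℕ} (p : Fin s → ℙ K (Fin (n + 1) → K)) : ℕ :=
  sInf {i : ℕ | ∃ q : Polynomial ℚ, ∀ j : ℕ, i ≤ j → (hilbertFunction p j : ℚ) = q.eval (j : ℚ)}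

/-- `X` is in generic position.  The degree of a set of `s` distinct `K`-rational points is `s`. -/
def IsInGenericPosition {K : Type*} [Field K] {n s : ℕ}
    (p : Fin s → ℙ K (Fin (n + 1) → K)) : Prop :=
  ∀ i : ℕ, hilbertFunction p i = min s ((n + i).choose n)

/-- The degree of `p_j` in `X`: the degree of a minimal separator of `X \ {p_j}` in `X`, i.e. the
least degree of a homogeneous form which does not vanish at `p_j` and vanishes at all the other
points (`X \ {p_j}` is the only maximal `p_j`-subscheme of a set of `K`-rational points). -/
def pointDegree {K : Type*} [Field K] {n s : ℕ} (p : Fin s → ℙ K (Fin (n + 1) → K))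
    (j : Fin s) : ℕ :=
  sInf {i : ℕ | ∃ f : MvPolynomial (Fin (n + 1)) K, f.IsHomogeneous i ∧
    MvPolynomial.eval (p j).rep f ≠ 0 ∧ ∀ k, k ≠ j → MvPolynomial.eval (p k).rep f = 0}

/-- `X` is a Cayley-Bacharach scheme. -/
def IsCBScheme {K : Type*} [Field K] {n s : ℕ} (p : Fin s → ℙ K (Fin (n + 1) → K)) : Prop :=
  ∀ j, pointDegree p j = regularityIndex p

/-- The image `x_i` of the indeterminate `X_i` in `R`. -/
def coord {K : Type*} [Field K] {n s : ℕ} (p : Fin s → ℙ K (Fin (n + 1) → K))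
    (i : Fin (n + 1)) : CoordRing p :=
  Ideal.Quotient.mk (vanishingIdeal p) (MvPolynomial.X i)

/-- The initial Fitting ideal of a module generated by `m_1, ..., m_n`: the ideal generated by the
determinants of all `n × n`-matrices whose rows are relations between `m_1, ..., m_n`. (By
Fitting's lemma it depends on the module only.) -/
def initialFittingIdeal {A M : Type*} [CommRing A] [AddCommGroup M] [Module A M] {n : ℕ}
    (m : Fin n → M) : Ideal A :=
  Ideal.span {d | ∃ B : Matrix (Fin n) (Fin n) A, (∀ i, ∑ k, B i k • m k = 0) ∧ d = B.det}

/-- The generators `dx_1, ..., dx_n` of the module of Kähler differentials of `R / K[x_0]`. -/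
def differentials {K : Type*} [Field K] {n s : ℕ} (p : Fin s → ℙ K (Fin (n + 1) → K))
    (k : Fin n) : Ω[CoordRing p⁄Algebra.adjoin K {coord p 0}] :=
  KaehlerDifferential.D (Algebra.adjoin K {coord p 0}) (CoordRing p) (coord p k.succ)

/-- The differentials `dx_1, ..., dx_n` do generate the module. -/
theorem span_differentials {K : Type*} [Field K] {n s : ℕ}
    (p : Fin s → ℙ K (Fin (n + 1) → K)) :
    Submodule.span (CoordRing p) (Set.range (differentials p)) = ⊤ := by
  rw [eq_top_iff, ← KaehlerDifferential.span_range_derivation, Submodule.span_le]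
  rintro _ ⟨f, rfl⟩
  obtain ⟨F, rfl⟩ := Ideal.Quotient.mk_surjective f
  induction F using MvPolynomial.induction_on with
  | C a =>
    have : (Ideal.Quotient.mk (vanishingIdeal p)) (MvPolynomial.C a) =
        algebraMap (Algebra.adjoin K {coord p 0}) (CoordRing p)
          (algebraMap K (Algebra.adjoin K {coord p 0}) a) := rfl
    rw [this, Derivation.map_algebraMap]
    exact Submodule.zero_mem _
  | add F G hF hG =>
    rw [map_add, map_add]
    exact Submodule.add_mem _ hF hG
  | mul_X F i hF =>
    rw [map_mul, Derivation.leibniz]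
    refine Submodule.add_mem _ (Submodule.smul_mem _ _ ?_) (Submodule.smul_mem _ _ hF)
    refine Fin.cases ?_ (fun k => ?_) i
    · have : (Ideal.Quotient.mk (vanishingIdeal p)) (MvPolynomial.X 0) =
          algebraMap (Algebra.adjoin K {coord p 0}) (CoordRing p)
            ⟨coord p 0, Algebra.subset_adjoin rfl⟩ := rfl
      rw [this, Derivation.map_algebraMap]
      exact Submodule.zero_mem _
    · exact Submodule.subset_span ⟨k, rfl⟩

/-- The Kähler different `ϑ_X`, the initial Fitting ideal of the module of Kähler differentials of
`R / K[x_0]`. -/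
def kaehlerDifferent {K : Type*} [Field K] {n s : ℕ} (p : Fin s → ℙ K (Fin (n + 1) → K)) :
    Ideal (CoordRing p) :=
  initialFittingIdeal (differentials p)

/-- The homogeneous component `(ϑ_X)_d`. -/
def kaehlerDifferentPart {K : Type*} [Field K] {n s : ℕ} (p : Fin s → ℙ K (Fin (n + 1) → K))
    (d : ℕ) : Submodule K (CoordRing p) :=
  (kaehlerDifferent p).restrictScalars K ⊓ ringPart p d

/-- The Jacobian determinant `∂(F_{i_1}, ..., F_{i_n}) / ∂(X_1, ..., X_n)` for an index set
`i_1 < ... < i_n` (there is no derivative with respect to `X_0`). -/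
def jacobianMinor {K : Type*} [Field K] {n t : ℕ} (F : Fin t → MvPolynomial (Fin (n + 1)) K)
    (e : Fin n ↪o Fin t) : MvPolynomial (Fin (n + 1)) K :=
  (Matrix.of fun a b : Fin n => MvPolynomial.pderiv b.succ (F (e a))).det

/-- The representative `(1, a_1, ..., a_n)` of a projective point with non-zero `0`-th
coordinate. -/
def normRep {K : Type*} [Field K] {n : ℕ} (q : ℙ K (Fin (n + 1) → K)) : Fin (n + 1) → K :=
  fun i => q.rep i / q.rep 0

/-- The matrix of the values of the Jacobian minors at the points. -/
def valueMatrix {K : Type*} [Field K] {n s t : ℕ} (p : Fin s → ℙ K (Fin (n + 1) → K))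
    (F : Fin t → MvPolynomial (Fin (n + 1)) K) : Matrix (Fin s) (Fin n ↪o Fin t) K :=
  Matrix.of fun j e => MvPolynomial.eval (normRep (p j)) (jacobianMinor F e)

/-- The matrix of values augmented by the `j`-th standard basis column. -/
def augmentedMatrix {K : Type*} [Field K] {n s t : ℕ} (p : Fin s → ℙ K (Fin (n + 1) → K))
    (F : Fin t → MvPolynomial (Fin (n + 1)) K) (j : Fin s) :
    Matrix (Fin s) ((Fin n ↪o Fin t) ⊕ Unit) K :=
  Matrix.fromCols (valueMatrix p F) (Matrix.replicateCol Unit (Pi.single j (1 : K)))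

end KaehlerCB

end

namespace KaehlerCB

open MvPolynomial

/-! ### Multilinear and alternating maps on spans -/

section Multilinear

/-! Generic position gives `r = α`, where `r` is the regularity index and `α` the initial degree;
put `d = α - 1`. Then `X` is a CB-scheme iff no standard basis vector `E_j` is the vector of values
of a form of degree `d`.

Claim 1: the relations among `dx_1, ..., dx_n` are spanned by the gradients of elements of `I_X`, so
the Kähler different is generated by Jacobians of forms in `I_X`. A non-zero such Jacobian has
degree at least `n * d`, with equality only if all its forms have degree `α`; these are combinations
of the `F_i`.

Claim 2: a form `f` of degree `d` separating `p_j` gives forms `(X_i - a_{ji} X_0) f` of degree `α`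
in `I_X`. Their Jacobian matrix is `f(p_j)` times the identity at `p_j` and has rank at most one at
the other points. So their Jacobian determinant separates `p_j`, and `E_j` is in the column space of
`𝒜`.

Claim 3: difference quotients of `n` forms of degree `d + 1` in `I_X` form a matrix whose
determinant, as a function on pairs of points, vanishes off the diagonal and equals the Jacobian on
it. It is a sum of products of a form in the first point and a form in the second, of total degree
at most `n * d`. By CB, some functional `φ` kills the values of forms of degree `d` but not `E_j`.
Contracting the second point with `φ` leaves forms of degree at most `n * d - d - 1 ≤ d` in the
first, so `φ` times the Jacobian is a vector of values in degree `d`. Were `E_j` in the column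
space, `φ(E_j) E_j` would be such a vector, a contradiction. -/

theorem multilinear_mem_span_of_forall_mem_span {A M N ι : Type*} [CommRing A] [AddCommGroup M]
    [Module A M] [AddCommGroup N] [Module A N] [Fintype ι] [DecidableEq ι]
    (f : MultilinearMap A (fun _ : ι => M) N) (S : Set M) (v : ι → M)
    (hv : ∀ i, v i ∈ Submodule.span A S) :
    f v ∈ Submodule.span A {y | ∃ w : ι → M, (∀ i, w i ∈ S) ∧ f w = y} := by
  -- `T` holds the slots not yet reduced to elements of `S`; linearity is used in one slot at a
  -- time.
  suffices h : ∀ (T : Finset ι) (v : ι → M), (∀ i ∈ T, v i ∈ Submodule.span A S) →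
      (∀ i ∉ T, v i ∈ S) →
      f v ∈ Submodule.span A {y | ∃ w : ι → M, (∀ i, w i ∈ S) ∧ f w = y} from
    h Finset.univ v (fun i _ => hv i) (fun i hi => absurd (Finset.mem_univ i) hi)
  intro T
  induction T using Finset.induction_on with
  | empty =>
    intro v _ h
    exact Submodule.subset_span ⟨v, fun i => h i (Finset.notMem_empty i), rfl⟩
  | insert a T ha ih =>
    intro v h₁ h₂
    suffices h : ∀ x ∈ Submodule.span A S, f (Function.update v a x) ∈
        Submodule.span A {y | ∃ w : ι → M, (∀ i, w i ∈ S) ∧ f w = y} by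
      have := h (v a) (h₁ a (Finset.mem_insert_self a T))
      rwa [Function.update_eq_self] at this
    intro x hx
    induction hx using Submodule.span_induction with
    | mem x hx =>
      apply ih
      · intro i hi
        have hia : i ≠ a := by rintro rfl; exact ha hi
        rw [Function.update_of_ne hia]
        exact h₁ i (Finset.mem_insert_of_mem hi)
      · intro i hi
        by_cases hia : i = a
        · subst hia; simpa using hx
        · rw [Function.update_of_ne hia]
          exact h₂ i (by simp [hia, hi])
    | zero => rw [f.map_update_zero]; exact Submodule.zero_mem _
    | add x y _ _ hx hy => rw [f.map_update_add]; exact Submodule.add_mem _ hx hy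
    | smul c x _ hx => rw [f.map_update_smul]; exact Submodule.smul_mem _ _ hx

/-- A family in the image of `F` is, up to a permutation, an increasing subfamily of `F`. -/
theorem alternating_mem_span_orderEmb {A M N : Type*} [CommRing A] [AddCommGroup M]
    [Module A M] [AddCommGroup N] [Module A N] {n t : ℕ} (f : M [⋀^Fin n]→ₗ[A] N)
    (F : Fin t → M) (v : Fin n → M) (hv : ∀ i, v i ∈ Submodule.span A (Set.range F)) :
    f v ∈ Submodule.span A (Set.range fun e : Fin n ↪o Fin t => f (F ∘ e)) := by
  refine (Submodule.span_le.2 ?_)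
    (multilinear_mem_span_of_forall_mem_span f.toMultilinearMap _ v hv)
  rintro _ ⟨w, hw, rfl⟩
  choose g hg using hw
  obtain rfl : F ∘ g = w := funext hg
  change f (F ∘ g) ∈ _
  by_cases hinj : Function.Injective g
  · have hmono : StrictMono (g ∘ Tuple.sort g) :=
      (Tuple.monotone_sort g).strictMono_of_injective (hinj.comp (Tuple.sort g).injective)
    have h := f.map_perm (F ∘ (g ∘ Tuple.sort g)) (Tuple.sort g)⁻¹
    have h' : (F ∘ (g ∘ Tuple.sort g)) ∘ ((Tuple.sort g)⁻¹ : Equiv.Perm (Fin n)) = F ∘ g := by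
      funext i; simp
    rw [← h', h]
    refine Submodule.smul_of_tower_mem _ _ (Submodule.subset_span ?_)
    exact ⟨OrderEmbedding.ofStrictMono _ hmono, rfl⟩
  · have : ¬ Function.Injective (F ∘ g) := fun h => hinj (Function.Injective.of_comp h)
    rw [f.map_eq_zero_of_not_injective _ this]
    exact Submodule.zero_mem _

end Multilinear

/-! ### Gradients and Jacobians in `X_1, ..., X_n` -/

section Gradient

variable {K : Type*} [Field K] {n : ℕ}

/-- The partial derivatives of a polynomial with respect to all variables but `X_0`. -/
noncomputable def grad : MvPolynomial (Fin (n + 1)) K →ₗ[K] (Fin n → MvPolynomial (Fin (n + 1)) K) :=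
  LinearMap.pi fun k => (pderiv k.succ).toLinearMap

@[simp] theorem grad_apply (F : MvPolynomial (Fin (n + 1)) K) (k : Fin n) :
    grad F k = pderiv k.succ F := rfl

/-- The Jacobian determinant of `n` polynomials, as an alternating map. -/
noncomputable def jacobian :
    MvPolynomial (Fin (n + 1)) K [⋀^Fin n]→ₗ[K] MvPolynomial (Fin (n + 1)) K :=
  { ((Matrix.detRowAlternating (n := Fin n)
      (R := MvPolynomial (Fin (n + 1)) K)).toMultilinearMap.restrictScalars K).compLinearMap
      (fun _ => grad) with
    map_eq_zero_of_eq' := fun v _ _ h hij =>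
      (Matrix.detRowAlternating (n := Fin n)
        (R := MvPolynomial (Fin (n + 1)) K)).map_eq_zero_of_eq
          (fun i => grad (v i)) (congrArg grad h) hij }

theorem jacobian_apply (v : Fin n → MvPolynomial (Fin (n + 1)) K) :
    jacobian v = (Matrix.of fun a b : Fin n => pderiv b.succ (v a)).det := rfl

theorem jacobianMinor_eq {t : ℕ} (F : Fin t → MvPolynomial (Fin (n + 1)) K) (e : Fin n ↪o Fin t) :
    jacobianMinor F e = jacobian (F ∘ e) := rfl

/-- Each term of the determinant differentiates every `v i` once. Truncation at `d i = 0` is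
harmless, since a constant has derivative zero, which is homogeneous of every degree. -/
theorem isHomogeneous_jacobian (v : Fin n → MvPolynomial (Fin (n + 1)) K) (d : Fin n → ℕ)
    (hv : ∀ i, (v i).IsHomogeneous (d i)) : (jacobian v).IsHomogeneous (∑ i, (d i - 1)) := by
  rw [jacobian_apply, Matrix.det_apply]
  refine IsHomogeneous.sum _ _ _ fun σ _ => ?_
  rw [← mem_homogeneousSubmodule]
  refine Submodule.smul_of_tower_mem _ _ ?_
  rw [mem_homogeneousSubmodule, ← Equiv.sum_comp σ fun i => d i - 1]
  exact IsHomogeneous.prod _ _ _ fun i _ => (hv (σ i)).pderiv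

theorem eval_jacobian (v : Fin n → MvPolynomial (Fin (n + 1)) K) (x : Fin (n + 1) → K) :
    eval x (jacobian v) = (Matrix.of fun a b : Fin n => eval x (pderiv b.succ (v a))).det := by
  rw [jacobian_apply, RingHom.map_det]; rfl

end Gradient

/-! ### Homogeneity of the vanishing ideal -/

section IdealBasics

variable {K : Type*} [Field K] {n s : ℕ} (p : Fin s → ℙ K (Fin (n + 1) → K))

theorem homogeneousComponent_mem_vanishingIdeal {F : MvPolynomial (Fin (n + 1)) K}
    (hF : F ∈ vanishingIdeal p) (d : ℕ) : homogeneousComponent d F ∈ vanishingIdeal p := by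
  let _ := MvPolynomial.gradedAlgebra (σ := Fin (n + 1)) (R := K)
  refine homogeneousComponent_mem_of_mem ?_ hF d
  refine Ideal.homogeneous_span _ _ ?_
  rintro x ⟨⟨d, hd⟩, -⟩
  exact ⟨d, hd⟩

theorem eval_rep_eq_zero_of_mem {F : MvPolynomial (Fin (n + 1)) K}
    (hF : F ∈ vanishingIdeal p) (j : Fin s) : eval (p j).rep F = 0 := by
  have : vanishingIdeal p ≤ RingHom.ker (eval (p j).rep) :=
    Ideal.span_le.2 fun G hG => hG.2 j
  exact this hF

/-- As `D ≤ m`, only the constant term of `a` can contribute in degree `D`. -/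
theorem homogeneousComponent_mul_of_isHomogeneous {σ : Type*} (a H : MvPolynomial σ K) (m D : ℕ)
    (hH : H.IsHomogeneous m) (hD : D ≤ m) :
    homogeneousComponent D (a * H) = if m = D then C (coeff 0 a) * H else 0 := by
  have hterm (i : ℕ) : homogeneousComponent D (homogeneousComponent i a * H) =
      if D = i + m then homogeneousComponent i a * H else 0 := by
    rw [homogeneousComponent_of_mem ((homogeneousComponent_isHomogeneous i a).mul hH)]
  conv_lhs => rw [← sum_homogeneousComponent a]
  rw [Finset.sum_mul, map_sum, Finset.sum_congr rfl fun i _ => hterm i]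
  split_ifs with h
  · subst h
    rw [Finset.sum_eq_single 0]
    · simp
    · intro i _ hi; rw [if_neg (by omega)]
    · simp
  · exact Finset.sum_eq_zero fun i _ => if_neg (by omega)

end IdealBasics

/-! ### Values of forms, difference quotients and Jacobians at points -/

section Values

variable {K : Type*} [Field K] {n s : ℕ} (P : Fin s → Fin (n + 1) → K)

/-- The values of a polynomial at a family of points. -/
noncomputable def evalPoints : MvPolynomial (Fin (n + 1)) K →ₗ[K] (Fin s → K) :=
  LinearMap.pi fun j => (aeval (P j)).toLinearMap

@[simp] theorem evalPoints_apply (F : MvPolynomial (Fin (n + 1)) K) (j : Fin s) :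
    evalPoints P F j = eval (P j) F := by
  simp [evalPoints, aeval_eq_eval]

/-- The vectors of values of the forms of degree `d` at a family of points. -/
noncomputable def formValues (d : ℕ) : Submodule K (Fin s → K) :=
  (homogeneousSubmodule (Fin (n + 1)) K d).map (evalPoints P)

variable {P}

/-- Multiplication by `X_0`, which is `1` at every point, raises the degree without changing the
values. -/
theorem formValues_mono (hP : ∀ j, P j 0 = 1) {d e : ℕ} (h : d ≤ e) :
    formValues P d ≤ formValues P e := by
  rintro _ ⟨F, hF, rfl⟩
  refine ⟨X 0 ^ (e - d) * F, ?_, ?_⟩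
  · have := ((isHomogeneous_X_pow (R := K) (0 : Fin (n + 1)) (e - d)).mul hF)
    rwa [Nat.sub_add_cancel h] at this
  · funext j; simp [hP]

variable (P) in
/-- The functions on pairs of points given by bihomogeneous forms of total degree at most `m`. -/
noncomputable def pairValues (m : ℕ) : Submodule K (Fin s → Fin s → K) :=
  Submodule.span K {w | ∃ (a b : ℕ) (u v : MvPolynomial (Fin (n + 1)) K), a + b ≤ m ∧
    u.IsHomogeneous a ∧ v.IsHomogeneous b ∧ w = fun i j => eval (P i) u * eval (P j) v}

theorem mem_pairValues {m a b : ℕ} {u v : MvPolynomial (Fin (n + 1)) K} (h : a + b ≤ m)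
    (hu : u.IsHomogeneous a) (hv : v.IsHomogeneous b) :
    (fun i j => eval (P i) u * eval (P j) v) ∈ pairValues P m :=
  Submodule.subset_span ⟨a, b, u, v, h, hu, hv, rfl⟩

theorem mul_mem_pairValues {l m : ℕ} {x y : Fin s → Fin s → K} (hx : x ∈ pairValues P l)
    (hy : y ∈ pairValues P m) : x * y ∈ pairValues P (l + m) := by
  have h : pairValues P l * pairValues P m ≤ pairValues P (l + m) := by
    rw [pairValues, pairValues, Submodule.span_mul_span, Submodule.span_le]
    rintro _ ⟨_, ⟨a, b, u, v, hab, hu, hv, rfl⟩, _, ⟨c, d, u', v', hcd, hu', hv', rfl⟩, rfl⟩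
    refine Submodule.subset_span ⟨a + c, b + d, u * u', v * v', by omega, hu.mul hu', hv.mul hv', ?_⟩
    funext i j
    simp only [Pi.mul_apply, map_mul]
    ring
  exact h (Submodule.mul_mem_mul hx hy)

theorem prod_mem_pairValues {ι : Type*} (T : Finset ι) {m : ℕ} {f : ι → Fin s → Fin s → K}
    (hf : ∀ i ∈ T, f i ∈ pairValues P m) : ∏ i ∈ T, f i ∈ pairValues P (T.card * m) := by
  classical
  induction T using Finset.induction_on with
  | empty =>
    have := mem_pairValues (P := P) (m := 0) (a := 0) (b := 0) le_rfl (isHomogeneous_one _ _)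
      (isHomogeneous_one _ _)
    simp only [map_one, mul_one] at this
    simpa using! this
  | insert a T ha ih =>
    rw [Finset.prod_insert ha, Finset.card_insert_of_notMem ha, add_mul, one_mul, add_comm]
    exact mul_mem_pairValues (hf a (Finset.mem_insert_self _ _))
      (ih fun i hi => hf i (Finset.mem_insert_of_mem hi))

theorem det_mem_pairValues {m : ℕ} (A : Matrix (Fin n) (Fin n) (Fin s → Fin s → K))
    (hA : ∀ i k, A i k ∈ pairValues P m) : A.det ∈ pairValues P (n * m) := by
  rw [Matrix.det_apply]
  refine Submodule.sum_mem _ fun σ _ => Submodule.smul_of_tower_mem _ _ ?_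
  simpa using prod_mem_pairValues Finset.univ fun i _ => hA (σ i) i

/-- `A` is a family of difference quotients of `F` at the given points. -/
def IsDifferenceQuotient (P : Fin s → Fin (n + 1) → K) (F : MvPolynomial (Fin (n + 1)) K)
    (A : Fin n → Fin s → Fin s → K) : Prop :=
  (∀ i j, eval (P i) F - eval (P j) F = ∑ k, A k i j * (P i k.succ - P j k.succ)) ∧
    ∀ k i, A k i i = eval (P i) (pderiv k.succ F)

/-- `x_l G(x) - y_l G(y) = x_l (G(x) - G(y)) + (x_l - y_l) G(y)`; for `l = 0` the last term vanishes
because `x_0 = y_0 = 1`. -/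
theorem IsDifferenceQuotient.X_mul (hP : ∀ j, P j 0 = 1) {G : MvPolynomial (Fin (n + 1)) K}
    {A : Fin n → Fin s → Fin s → K} (hA : IsDifferenceQuotient P G A) (l : Fin (n + 1)) :
    IsDifferenceQuotient P (X l * G)
      fun k i j => P i l * A k i j + if k.succ = l then eval (P j) G else 0 := by
  refine ⟨fun i j => ?_, fun k i => ?_⟩
  · have h : ∑ k : Fin n, (if k.succ = l then eval (P j) G else 0) *
        (P i k.succ - P j k.succ) = eval (P j) G * (P i l - P j l) := by
      refine Fin.cases ?_ (fun k => ?_) l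
      · simp [hP]
      · simp only [Fin.succ_inj, ite_mul, zero_mul, Finset.sum_ite_eq', Finset.mem_univ, if_true]
    simp only [add_mul, Finset.sum_add_distrib, mul_assoc, h, ← Finset.mul_sum, ← hA.1 i j,
      map_mul, eval_X]
    ring
  · simp only [Derivation.leibniz, pderiv_X, hA.2, Pi.single_apply, smul_eq_mul, map_add, map_mul,
      eval_X]
    congr 1
    by_cases h : k.succ = l
    · simp [h]
    · simp [h, Ne.symm h]

/-- Forms of degree `d + 1` are spanned by products `X_l * G`, to which the product rule applies.
Bounding `P i l * A k i j` instead of `A k` lets the case `d = 0` be included, where the quotients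
of a constant are zero. -/
theorem exists_isDifferenceQuotient_succ (hP : ∀ j, P j 0 = 1) {d : ℕ}
    (h : ∀ G : MvPolynomial (Fin (n + 1)) K, G.IsHomogeneous d → ∃ A, IsDifferenceQuotient P G A ∧
      ∀ k l, (fun i j => P i l * A k i j) ∈ pairValues P d)
    (F : MvPolynomial (Fin (n + 1)) K) (hF : F.IsHomogeneous (d + 1)) :
    ∃ A, IsDifferenceQuotient P F A ∧ ∀ k, A k ∈ pairValues P d := by
  rw [← mem_homogeneousSubmodule, ← homogeneousSubmodule_one_pow, pow_succ',
    homogeneousSubmodule_one_pow, homogeneousSubmodule_one_eq_span_X,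
    ← Submodule.span_eq (homogeneousSubmodule (Fin (n + 1)) K d), Submodule.span_mul_span] at hF
  induction hF using Submodule.span_induction with
  | mem F hF =>
    obtain ⟨_, ⟨l, rfl⟩, G, hG, rfl⟩ := hF
    obtain ⟨A, hA, hmem⟩ := h G hG
    refine ⟨_, hA.X_mul hP l, fun k => Submodule.add_mem _ (hmem k l) ?_⟩
    split_ifs
    · simpa using mem_pairValues (P := P) (zero_add d).le (isHomogeneous_one _ _) hG
    · exact Submodule.zero_mem _
  | zero => exact ⟨0, ⟨by simp, by simp⟩, fun _ => Submodule.zero_mem _⟩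
  | add F G _ _ hF hG =>
    obtain ⟨A, hA, hA'⟩ := hF
    obtain ⟨B, hB, hB'⟩ := hG
    refine ⟨A + B, ⟨fun i j => ?_, fun k i => ?_⟩, fun k => Submodule.add_mem _ (hA' k) (hB' k)⟩
    · simp only [Pi.add_apply, add_mul, Finset.sum_add_distrib, ← hA.1, ← hB.1, map_add]
      ring
    · simp [hA.2, hB.2]
  | smul c F _ hF =>
    obtain ⟨A, hA, hA'⟩ := hF
    refine ⟨c • A, ⟨fun i j => ?_, fun k i => ?_⟩, fun k => Submodule.smul_mem _ c (hA' k)⟩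
    · simp only [Pi.smul_apply, smul_eq_mul, mul_assoc, ← Finset.mul_sum, ← hA.1, smul_eval]
      ring
    · simp [hA.2, smul_eval]

theorem exists_isDifferenceQuotient (hP : ∀ j, P j 0 = 1) (d : ℕ)
    (F : MvPolynomial (Fin (n + 1)) K) (hF : F.IsHomogeneous (d + 1)) :
    ∃ A, IsDifferenceQuotient P F A ∧ ∀ k, A k ∈ pairValues P d := by
  induction d generalizing F with
  | zero =>
    refine exists_isDifferenceQuotient_succ hP (fun G hG => ?_) F hF
    rw [← totalDegree_zero_iff_isHomogeneous, totalDegree_eq_zero_iff_eq_C] at hG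
    rw [hG]
    exact ⟨0, ⟨by simp, by simp⟩, fun k l => by
      simp only [Pi.zero_apply, mul_zero]
      exact Submodule.zero_mem (pairValues P 0)⟩
  | succ d ih =>
    refine exists_isDifferenceQuotient_succ hP (fun G hG => ?_) F hF
    obtain ⟨A, hA, hmem⟩ := ih G hG
    refine ⟨A, hA, fun k l => ?_⟩
    have := mul_mem_pairValues (mem_pairValues (P := P) (m := 1) (add_zero 1).le
      (isHomogeneous_X K l) (isHomogeneous_one _ _)) (hmem k)
    rw [add_comm d 1]
    simpa using! this

/-- Contraction of the second argument with a functional killing the forms of degree `c`. -/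
theorem contract_mem_formValues (hP : ∀ j, P j 0 = 1) {m c e : ℕ} (he : m ≤ c + 1 + e)
    (φ : Fin s → K) (hφ : ∀ v ∈ formValues P c, ∑ j, φ j * v j = 0) {w : Fin s → Fin s → K}
    (hw : w ∈ pairValues P m) : (fun i => ∑ j, φ j * w i j) ∈ formValues P e := by
  induction hw using Submodule.span_induction with
  | mem w hw =>
    obtain ⟨a, b, u, v, hab, hu, hv, rfl⟩ := hw
    have hfac : (fun i => ∑ j, φ j * (eval (P i) u * eval (P j) v)) =
        (∑ j, φ j * eval (P j) v) • evalPoints P u := by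
      funext i
      simp only [Pi.smul_apply, evalPoints_apply, smul_eq_mul, Finset.sum_mul]
      exact Finset.sum_congr rfl fun j _ => by ring
    rw [hfac]
    -- Either `φ` kills the second factor, or `b ≥ c + 1` and the first factor has degree `a ≤ m -
    -- (c + 1) ≤ e`.
    by_cases hb : b ≤ c
    · have := hφ (evalPoints P v) (formValues_mono hP hb ⟨v, hv, rfl⟩)
      simp only [evalPoints_apply] at this
      rw [this, zero_smul]
      exact Submodule.zero_mem _
    · exact Submodule.smul_mem _ _ (formValues_mono hP (by omega : a ≤ e) ⟨u, hu, rfl⟩)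
  | zero =>
    convert Submodule.zero_mem (formValues P e) using 1
    funext i
    simp
  | add x y _ _ hx hy =>
    convert Submodule.add_mem _ hx hy using 1
    funext i
    simp [mul_add, Finset.sum_add_distrib]
  | smul r x _ hx =>
    convert Submodule.smul_mem _ r hx using 1
    funext i
    simp only [Pi.smul_apply, smul_eq_mul, Finset.mul_sum]
    exact Finset.sum_congr rfl fun j _ => by ring

/-- The Jacobian of `n` forms vanishing at the points, multiplied by a functional that kills the
forms of degree `c`, takes the values of a form of degree `n * d - (c + 1)`. -/
theorem mul_jacobian_mem_formValues (hP : ∀ j, P j 0 = 1) (hinj : Function.Injective P)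
    {d c e : ℕ} (he : n * d ≤ c + 1 + e) (F : Fin n → MvPolynomial (Fin (n + 1)) K)
    (hF : ∀ i, (F i).IsHomogeneous (d + 1)) (hFP : ∀ i j, eval (P j) (F i) = 0)
    (φ : Fin s → K) (hφ : ∀ v ∈ formValues P c, ∑ j, φ j * v j = 0) :
    φ * evalPoints P (jacobian F) ∈ formValues P e := by
  choose A hAq hA using fun i => exists_isDifferenceQuotient hP d (F i) (hF i)
  have hdet (i j : Fin s) : (Matrix.of A).det i j = (Matrix.of fun a b => A a b i j).det := by
    simp only [Matrix.det_apply, Finset.sum_apply, Pi.smul_apply, Finset.prod_apply,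
      Matrix.of_apply]
  -- The matrix of quotients sends `P_i - P_j` to the differences of the values of the forms, which
  -- are all zero, and this vector is non-zero for distinct points.
  have hoff (i j : Fin s) (hij : i ≠ j) : (Matrix.of A).det i j = 0 := by
    rw [hdet]
    refine Matrix.exists_mulVec_eq_zero_iff.1 ⟨fun k => P i k.succ - P j k.succ, ?_, ?_⟩
    · intro h
      refine hij (hinj (funext fun k => ?_))
      refine Fin.cases (by rw [hP, hP]) (fun k => ?_) k
      exact sub_eq_zero.1 (congrFun h k)
    · funext a
      have := (hAq a).1 i j
      rw [hFP, hFP, sub_zero] at this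
      simpa [Matrix.mulVec, dotProduct] using this.symm
  have hdiag (i : Fin s) : (Matrix.of A).det i i = eval (P i) (jacobian F) := by
    rw [hdet, eval_jacobian]
    simp only [(hAq _).2]
  have := contract_mem_formValues hP he φ hφ (det_mem_pairValues (Matrix.of A) fun i k => hA i k)
  convert this using 1
  -- The contraction over `j` collapses to its diagonal term.
  funext i
  rw [Finset.sum_eq_single i]
  · simp [hdiag]
  · intro j _ hj
    rw [hoff i j hj.symm, mul_zero]
  · simp

/-- If the forms of degree `d` separate `p_j` from the other points, then the Jacobians of suitable
forms of degree `d + 1` vanishing at all points separate it as well. -/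
theorem exists_jacobian_separator (hn : 2 ≤ n) (hP : ∀ j, P j 0 = 1) {d : ℕ} (j : Fin s)
    (f : MvPolynomial (Fin (n + 1)) K) (hf : f.IsHomogeneous d) (hfj : eval (P j) f ≠ 0)
    (hfk : ∀ k, k ≠ j → eval (P k) f = 0) :
    ∃ F : Fin n → MvPolynomial (Fin (n + 1)) K, (∀ i, (F i).IsHomogeneous (d + 1)) ∧
      (∀ i k, eval (P k) (F i) = 0) ∧ eval (P j) (jacobian F) ≠ 0 ∧
      ∀ k, k ≠ j → eval (P k) (jacobian F) = 0 := by
  have hpd (i k : Fin n) : pderiv k.succ ((X i.succ - C (P j i.succ) * X 0) * f) =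
      (X i.succ - C (P j i.succ) * X 0) * pderiv k.succ f + (if i = k then 1 else 0) * f := by
    rw [Derivation.leibniz, map_sub, Derivation.leibniz, derivation_C, pderiv_X, pderiv_X]
    simp only [Pi.single_apply, smul_eq_mul, Fin.succ_inj, mul_zero, if_false,
      (Fin.succ_ne_zero _).symm, sub_zero, add_zero]
    rw [mul_comm f]
  -- The linear factors `ℓ_i` vanish at `P_j`. By the product rule the Jacobian matrix is `f` times
  -- the identity plus `(ℓ_i ∂_k f)`: the second summand vanishes at `P_j`, the first at the other
  -- points, where rank at most one and `n ≥ 2` force determinant zero.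
  refine ⟨fun i => (X i.succ - C (P j i.succ) * X 0) * f, ?_, ?_, ?_, ?_⟩
  · intro i
    rw [add_comm d 1]
    exact ((isHomogeneous_X _ _).sub (isHomogeneous_C_mul_X _ _)).mul hf
  · intro i k
    by_cases hk : k = j
    · subst hk; simp [hP]
    · simp [hfk k hk]
  · rw [eval_jacobian]
    simp only [hpd]
    have : (Matrix.of fun a b : Fin n => eval (P j) ((X a.succ - C (P j a.succ) * X 0) *
        pderiv b.succ f + (if a = b then 1 else 0) * f)) =
        Matrix.diagonal fun _ => eval (P j) f := by
      ext a b
      simp only [Matrix.of_apply, Matrix.diagonal_apply]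
      split_ifs <;> simp [hP]
    rw [this, Matrix.det_diagonal]
    exact Finset.prod_ne_zero_iff.2 fun _ _ => hfj
  · intro k hk
    rw [eval_jacobian]
    simp only [hpd]
    have : (Matrix.of fun a b : Fin n => eval (P k) ((X a.succ - C (P j a.succ) * X 0) *
        pderiv b.succ f + (if a = b then 1 else 0) * f)) =
        Matrix.vecMulVec (fun a => P k a.succ - P j a.succ)
          fun b => eval (P k) (pderiv b.succ f) := by
      ext a b
      simp only [Matrix.of_apply]
      split_ifs <;> simp [Matrix.vecMulVec_apply, hP, hfk k hk]
    rw [this]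
    have : Nontrivial (Fin n) := Fin.nontrivial_iff_two_le.2 hn
    exact Matrix.det_vecMulVec _ _

end Values

/-! ### The Kähler different and its component of least degree -/

section Kaehler

variable {K : Type*} [Field K] {n s : ℕ} (p : Fin s → ℙ K (Fin (n + 1) → K))

/-- The residue classes of the partial derivatives with respect to `X_1, ..., X_n`. -/
noncomputable def gradMk (F : MvPolynomial (Fin (n + 1)) K) : Fin n → CoordRing p :=
  fun k => Ideal.Quotient.mk (vanishingIdeal p) (grad F k)

theorem gradMk_add (F G : MvPolynomial (Fin (n + 1)) K) :
    gradMk p (F + G) = gradMk p F + gradMk p G := by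
  funext k; simp [gradMk]

theorem gradMk_sub (F G : MvPolynomial (Fin (n + 1)) K) :
    gradMk p (F - G) = gradMk p F - gradMk p G := by
  funext k; simp [gradMk]

theorem gradMk_mul (F G : MvPolynomial (Fin (n + 1)) K) :
    gradMk p (F * G) = Ideal.Quotient.mk (vanishingIdeal p) F • gradMk p G +
      Ideal.Quotient.mk (vanishingIdeal p) G • gradMk p F := by
  funext k; simp [gradMk]

/-- The module of relations spanned by the gradients of the elements of the ideal. -/
noncomputable def gradRelations : Submodule (CoordRing p) (Fin n → CoordRing p) :=
  Submodule.span (CoordRing p) (gradMk p '' (vanishingIdeal p : Set _))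

/-- The value of the total derivative with respect to `X_1, ..., X_n`. -/
noncomputable def totalDerivative (f : CoordRing p) :
    (Fin n → CoordRing p) ⧸ gradRelations p :=
  (gradRelations p).mkQ (gradMk p (Function.surjInv Ideal.Quotient.mk_surjective f))

/-- Two lifts differ by an element of the ideal, whose gradient is zero modulo `gradRelations`. -/
theorem totalDerivative_mk (F : MvPolynomial (Fin (n + 1)) K) :
    totalDerivative p (Ideal.Quotient.mk (vanishingIdeal p) F) =
      (gradRelations p).mkQ (gradMk p F) := by
  rw [totalDerivative, ← sub_eq_zero, ← map_sub, ← gradMk_sub, Submodule.mkQ_apply,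
    Submodule.Quotient.mk_eq_zero]
  refine Submodule.subset_span ⟨_, ?_, rfl⟩
  rw [SetLike.mem_coe, ← Ideal.Quotient.eq]
  exact Function.surjInv_eq _ _

theorem totalDerivative_add (f g : CoordRing p) :
    totalDerivative p (f + g) = totalDerivative p f + totalDerivative p g := by
  obtain ⟨F, rfl⟩ := Ideal.Quotient.mk_surjective f
  obtain ⟨G, rfl⟩ := Ideal.Quotient.mk_surjective g
  rw [← map_add, totalDerivative_mk, totalDerivative_mk, totalDerivative_mk, gradMk_add, map_add]

theorem totalDerivative_mul (f g : CoordRing p) :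
    totalDerivative p (f * g) = f • totalDerivative p g + g • totalDerivative p f := by
  obtain ⟨F, rfl⟩ := Ideal.Quotient.mk_surjective f
  obtain ⟨G, rfl⟩ := Ideal.Quotient.mk_surjective g
  rw [← map_mul]
  simp only [totalDerivative_mk, gradMk_mul, map_add, map_smul]

theorem totalDerivative_of_mem_adjoin (f : CoordRing p)
    (hf : f ∈ Algebra.adjoin K {coord p 0}) : totalDerivative p f = 0 := by
  induction hf using Algebra.adjoin_induction with
  | mem x hx =>
    rw [Set.mem_singleton_iff.1 hx, coord, totalDerivative_mk]
    convert map_zero (gradRelations p).mkQ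
    funext k
    simp [gradMk, pderiv_X_of_ne (Fin.succ_ne_zero k).symm]
  | algebraMap r =>
    have : algebraMap K (CoordRing p) r = Ideal.Quotient.mk (vanishingIdeal p) (C r) := rfl
    rw [this, totalDerivative_mk]
    convert map_zero (gradRelations p).mkQ
    funext k
    simp [gradMk]
  | add x y _ _ hx hy => rw [totalDerivative_add, hx, hy, add_zero]
  | mul x y _ _ hx hy => rw [totalDerivative_mul, hx, hy, smul_zero, smul_zero, add_zero]

/-- The total derivative as a derivation over `K[x_0]`. -/
noncomputable def totalDerivation : Derivation (Algebra.adjoin K {coord p 0}) (CoordRing p)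
    ((Fin n → CoordRing p) ⧸ gradRelations p) :=
  Derivation.mk'
    { toFun := totalDerivative p
      map_add' := totalDerivative_add p
      map_smul' := fun a f => by
        rw [Algebra.smul_def, totalDerivative_mul, RingHom.id_apply]
        have : totalDerivative p (algebraMap (Algebra.adjoin K {coord p 0}) (CoordRing p) a) = 0 :=
          totalDerivative_of_mem_adjoin p _ a.2
        rw [this, smul_zero, add_zero, algebraMap_smul] }
    (totalDerivative_mul p)

/-- The linear map on differentials induced by `totalDerivation` sends `dx_k` to the class of the
`k`-th unit vector, so it turns the relation `B` into the statement that the class of `B` is zero.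
-/
theorem mem_gradRelations_of_relation (B : Fin n → CoordRing p)
    (hB : ∑ k, B k • differentials p k = 0) : B ∈ gradRelations p := by
  have h := congrArg (totalDerivation p).liftKaehlerDifferential hB
  have hk (k : Fin n) : (totalDerivation p).liftKaehlerDifferential (differentials p k) =
      (gradRelations p).mkQ (Pi.single k 1) := by
    rw [differentials, Derivation.liftKaehlerDifferential_comp_D]
    change totalDerivative p _ = _
    rw [coord, totalDerivative_mk]
    congr 1
    funext l
    by_cases hl : l = k
    · subst hl; simp [gradMk]
    · rw [Pi.single_eq_of_ne hl, gradMk, grad_apply,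
        pderiv_X_of_ne (fun h => hl (Fin.succ_injective _ h).symm), map_zero]
  simp only [map_sum, map_smul, map_zero, hk] at h
  simp only [← map_smul, ← map_sum] at h
  rw [Submodule.mkQ_apply, Submodule.Quotient.mk_eq_zero] at h
  convert h
  funext l
  simp [Finset.sum_apply, Pi.single_apply]

/-- The chain rule for a derivation of the coordinate ring which kills `K` and `x_0`. -/
theorem sum_gradMk_smul_derivation {A M : Type*} [CommRing A] [Algebra A (CoordRing p)]
    [AddCommGroup M] [Module (CoordRing p) M] [Module A M] (D : Derivation A (CoordRing p) M)
    (hC : ∀ a, D (Ideal.Quotient.mk (vanishingIdeal p) (C a)) = 0) (h0 : D (coord p 0) = 0)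
    (F : MvPolynomial (Fin (n + 1)) K) :
    ∑ k, gradMk p F k • D (coord p k.succ) = D (Ideal.Quotient.mk (vanishingIdeal p) F) := by
  induction F using MvPolynomial.induction_on with
  | C a =>
    rw [hC]
    refine Finset.sum_eq_zero fun k _ => ?_
    rw [gradMk, grad_apply, pderiv_C, map_zero]
    exact zero_smul (CoordRing p) (D _)
  | add F G hF hG =>
    simp only [gradMk_add, Pi.add_apply, add_smul, Finset.sum_add_distrib, hF, hG, map_add]
  | mul_X F i hF =>
    simp only [gradMk_mul, Pi.add_apply, Pi.smul_apply, add_smul, Finset.sum_add_distrib,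
      smul_assoc, ← Finset.smul_sum, hF, map_mul, Derivation.leibniz]
    congr 2
    refine Fin.cases ?_ (fun l => ?_) i
    · change _ = D (coord p 0)
      rw [h0]
      refine Finset.sum_eq_zero fun k _ => ?_
      rw [gradMk, grad_apply, pderiv_X_of_ne (Fin.succ_ne_zero k).symm, map_zero]
      exact zero_smul (CoordRing p) (D _)
    · rw [Finset.sum_eq_single l]
      · simp [gradMk, coord]
      · intro k _ hk
        rw [gradMk, grad_apply, pderiv_X_of_ne (fun h => hk (Fin.succ_injective _ h).symm), map_zero]
        exact zero_smul (CoordRing p) (D _)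
      · simp

theorem sum_gradMk_smul_differentials (F : MvPolynomial (Fin (n + 1)) K) :
    ∑ k, gradMk p F k • differentials p k =
      KaehlerDifferential.D (Algebra.adjoin K {coord p 0}) (CoordRing p)
        (Ideal.Quotient.mk (vanishingIdeal p) F) :=
  sum_gradMk_smul_derivation p _
    (fun a => Derivation.map_algebraMap _ (algebraMap K (Algebra.adjoin K {coord p 0}) a))
    (Derivation.map_algebraMap _
      (⟨coord p 0, Algebra.subset_adjoin rfl⟩ : Algebra.adjoin K {coord p 0})) F

theorem mk_jacobian (v : Fin n → MvPolynomial (Fin (n + 1)) K) :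
    Ideal.Quotient.mk (vanishingIdeal p) (jacobian v) =
      (Matrix.of fun i k => gradMk p (v i) k).det := by
  rw [jacobian_apply, RingHom.map_det]; rfl

/-- The rows are relations among the `dx_k`, since an element of the ideal has zero differential in
the quotient. -/
theorem mk_jacobian_mem_kaehlerDifferent (v : Fin n → MvPolynomial (Fin (n + 1)) K)
    (hv : ∀ i, v i ∈ vanishingIdeal p) :
    Ideal.Quotient.mk (vanishingIdeal p) (jacobian v) ∈ kaehlerDifferent p := by
  refine Ideal.subset_span ⟨_, fun i => ?_, mk_jacobian p v⟩
  simp only [Matrix.of_apply]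
  rw [sum_gradMk_smul_differentials, Ideal.Quotient.eq_zero_iff_mem.2 (hv i), map_zero]

theorem gradMk_mem_span_homogeneous {F : MvPolynomial (Fin (n + 1)) K}
    (hF : F ∈ vanishingIdeal p) : gradMk p F ∈ Submodule.span (CoordRing p)
      {v | ∃ G d, G ∈ vanishingIdeal p ∧ G.IsHomogeneous d ∧ gradMk p G = v} := by
  have : gradMk p F = ∑ i ∈ Finset.range (F.totalDegree + 1),
      gradMk p (homogeneousComponent i F) := by
    conv_lhs => rw [← sum_homogeneousComponent F]
    funext k
    simp [gradMk]
  rw [this]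
  exact Submodule.sum_mem _ fun i _ => Submodule.subset_span
    ⟨_, i, homogeneousComponent_mem_vanishingIdeal p hF i, homogeneousComponent_isHomogeneous i F,
      rfl⟩

/-- The Kähler different is generated by the Jacobians of forms in the vanishing ideal. -/
theorem kaehlerDifferent_eq_span_jacobian : kaehlerDifferent p =
    Ideal.span (Ideal.Quotient.mk (vanishingIdeal p) ''
      {H | ∃ (v : Fin n → MvPolynomial (Fin (n + 1)) K) (d : Fin n → ℕ),
        (∀ i, v i ∈ vanishingIdeal p ∧ (v i).IsHomogeneous (d i)) ∧ jacobian v = H}) := by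
  refine le_antisymm (Ideal.span_le.2 ?_) (Ideal.span_le.2 ?_)
  · rintro _ ⟨B, hB, rfl⟩
    have hle : gradRelations p ≤ Submodule.span (CoordRing p)
        {v | ∃ G d, G ∈ vanishingIdeal p ∧ G.IsHomogeneous d ∧ gradMk p G = v} := by
      refine Submodule.span_le.2 ?_
      rintro _ ⟨F, hF, rfl⟩
      exact gradMk_mem_span_homogeneous p hF
    -- Multilinearity of the determinant in its rows reduces to rows that are gradients of forms.
    have h := multilinear_mem_span_of_forall_mem_span
      (Matrix.detRowAlternating (n := Fin n) (R := CoordRing p)).toMultilinearMap _ B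
      fun i => hle (mem_gradRelations_of_relation p (B i) (hB i))
    refine Submodule.span_mono ?_ h
    rintro _ ⟨w, hw, rfl⟩
    choose v d hv hd hvw using hw
    refine ⟨jacobian v, ⟨v, d, fun i => ⟨hv i, hd i⟩, rfl⟩, ?_⟩
    rw [mk_jacobian]
    simp only [hvw]
    rfl
  · rintro _ ⟨_, ⟨v, d, hv, rfl⟩, rfl⟩
    exact mk_jacobian_mem_kaehlerDifferent p v fun i => (hv i).1

/-- The component of least degree of an ideal generated by classes of forms. -/
theorem homogeneousComponent_mem_span {S : Set (MvPolynomial (Fin (n + 1)) K)} {D : ℕ}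
    (hS : ∀ H ∈ S, ∃ m, D ≤ m ∧ H.IsHomogeneous m) {G : MvPolynomial (Fin (n + 1)) K}
    (hG : G ∈ Ideal.span S) :
    homogeneousComponent D G ∈ Submodule.span K {H ∈ S | H.IsHomogeneous D} := by
  obtain ⟨N, a, g, rfl⟩ := Submodule.mem_span_set'.1 hG
  rw [map_sum]
  refine Submodule.sum_mem _ fun i _ => ?_
  obtain ⟨m, hm, hH⟩ := hS _ (g i).2
  rw [smul_eq_mul, homogeneousComponent_mul_of_isHomogeneous _ _ m D hH hm]
  split_ifs with h
  · rw [← smul_eq_C_mul]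
    exact Submodule.smul_mem _ _ (Submodule.subset_span ⟨(g i).2, h ▸ hH⟩)
  · exact Submodule.zero_mem _

theorem le_of_mem_vanishingIdeal {F : MvPolynomial (Fin (n + 1)) K} {d : ℕ}
    (hF : F ∈ vanishingIdeal p) (hd : F.IsHomogeneous d) (h0 : F ≠ 0) : initialDegree p ≤ d :=
  Nat.sInf_le fun h => h0 ((Submodule.eq_bot_iff _).1 h F ⟨hF, hd⟩)

/-- Forms in the ideal with non-zero Jacobian all have degree at least the initial degree, so `D` is
the least possible degree of a generator of the different. There only scalar multiples of generators
contribute, and alternation leaves the increasing index sets. -/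
theorem span_jacobianMinor_eq {t : ℕ} (hα : 1 ≤ initialDegree p)
    (F : Fin t → MvPolynomial (Fin (n + 1)) K)
    (hF : Submodule.span K (Set.range F) = idealPart p (initialDegree p)) :
    Submodule.span K (Set.range fun e : Fin n ↪o Fin t =>
        Ideal.Quotient.mk (vanishingIdeal p) (jacobianMinor F e)) =
      kaehlerDifferentPart p (n * (initialDegree p - 1)) := by
  have hFmem (i : Fin t) : F i ∈ idealPart p (initialDegree p) :=
    hF ▸ Submodule.subset_span ⟨i, rfl⟩
  refine le_antisymm (Submodule.span_le.2 ?_) ?_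
  · rintro _ ⟨e, rfl⟩
    refine ⟨mk_jacobian_mem_kaehlerDifferent p (F ∘ e) fun i => (hFmem (e i)).1, ?_⟩
    refine ⟨jacobianMinor F e, ?_, rfl⟩
    have := isHomogeneous_jacobian (F ∘ e) (fun _ => initialDegree p) fun i => (hFmem (e i)).2
    simpa [← jacobianMinor_eq] using this
  · rintro f ⟨hf, G, hG, rfl⟩
    set D := n * (initialDegree p - 1) with hD
    set S : Set (MvPolynomial (Fin (n + 1)) K) := {H | ∃ (v : Fin n → MvPolynomial (Fin (n + 1)) K)
        (d : Fin n → ℕ), (∀ i, v i ∈ vanishingIdeal p ∧ (v i).IsHomogeneous (d i)) ∧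
          jacobian v = H} with hS
    have hle (v : Fin n → MvPolynomial (Fin (n + 1)) K) (d : Fin n → ℕ)
        (hv : ∀ i, v i ∈ vanishingIdeal p ∧ (v i).IsHomogeneous (d i)) (h0 : jacobian v ≠ 0)
        (i : Fin n) : initialDegree p ≤ d i :=
      le_of_mem_vanishingIdeal p (hv i).1 (hv i).2 fun h => h0 (jacobian.map_coord_zero i h)
    have hSdeg : ∀ H ∈ S, ∃ m, D ≤ m ∧ H.IsHomogeneous m := by
      rintro _ ⟨v, d, hv, rfl⟩
      by_cases h0 : jacobian v = 0
      · exact ⟨D, le_rfl, h0 ▸ isHomogeneous_zero _ _ _⟩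
      refine ⟨_, ?_, isHomogeneous_jacobian v d fun i => (hv i).2⟩
      calc D = ∑ _i : Fin n, (initialDegree p - 1) := by simp [hD]
        _ ≤ ∑ i, (d i - 1) := Finset.sum_le_sum fun i _ => Nat.sub_le_sub_right (hle v d hv h0 i) 1
    have hspan : {H ∈ S | H.IsHomogeneous D} ⊆ (Submodule.span K
        (Set.range fun e : Fin n ↪o Fin t => jacobianMinor F e) : Set _) := by
      rintro _ ⟨⟨v, d, hv, rfl⟩, hH⟩
      by_cases h0 : jacobian v = 0
      · rw [h0]; exact Submodule.zero_mem _
      refine alternating_mem_span_orderEmb jacobian F v fun i => ?_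
      -- A non-zero polynomial has only one degree; equal sums of termwise comparable numbers then
      -- agree term by term.
      have hsum : ∑ _i : Fin n, (initialDegree p - 1) = ∑ i, (d i - 1) := by
        rw [(isHomogeneous_jacobian v d fun i => (hv i).2).inj_right hH h0]
        simp [hD]
      have := (Finset.sum_eq_sum_iff_of_le fun i _ =>
        Nat.sub_le_sub_right (hle v d hv h0 i) 1).1 hsum i (Finset.mem_univ i)
      have hdi : d i = initialDegree p := by have := hle v d hv h0 i; omega
      rw [hF, ← hdi]
      exact hv i
    change Ideal.Quotient.mk _ G ∈ kaehlerDifferent p at hf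
    rw [kaehlerDifferent_eq_span_jacobian, ← Ideal.map_span,
      Ideal.mem_map_iff_of_surjective _ Ideal.Quotient.mk_surjective] at hf
    obtain ⟨G', hG', hGG'⟩ := hf
    have h1 := Submodule.span_le.2 hspan (homogeneousComponent_mem_span hSdeg hG')
    -- The lift `G'` need not be homogeneous; as the vanishing ideal is, its component of degree `D`
    -- lifts the same class.
    have h2 : Ideal.Quotient.mk (vanishingIdeal p) G =
        Ideal.Quotient.mk (vanishingIdeal p) (homogeneousComponent D G') := by
      rw [eq_comm, Ideal.Quotient.eq, ← homogeneousComponent_eq_self hG, ← map_sub]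
      exact homogeneousComponent_mem_vanishingIdeal p (Ideal.Quotient.eq.1 hGG') D
    have h3 := Submodule.mem_map_of_mem (f := (Ideal.Quotient.mkₐ K (vanishingIdeal p)).toLinearMap)
      h1
    rw [Submodule.map_span, ← Set.range_comp] at h3
    change Ideal.Quotient.mk (vanishingIdeal p) G ∈ _
    rw [h2]
    exact h3

end Kaehler

/-! ### Normalised points, regularity index, separators and ranks -/

section Points

variable {K : Type*} [Field K] {n s : ℕ} {p : Fin s → ℙ K (Fin (n + 1) → K)}

theorem eval_smul_of_isHomogeneous {σ : Type*} {F : MvPolynomial σ K} {d : ℕ}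
    (hF : F.IsHomogeneous d) (c : K) (x : σ → K) : eval (c • x) F = c ^ d * eval x F := by
  simp only [eval_eq, Finset.mul_sum]
  refine Finset.sum_congr rfl fun m hm => ?_
  simp only [Pi.smul_apply, smul_eq_mul, mul_pow, Finset.prod_mul_distrib,
    Finset.prod_pow_eq_pow_sum]
  rw [← hF.degree_eq_sum_deg_support hm]
  ring

theorem normRep_zero (hp0 : ∀ j, (p j).rep 0 ≠ 0) (j : Fin s) : normRep (p j) 0 = 1 :=
  div_self (hp0 j)

theorem rep_eq_smul_normRep {q : ℙ K (Fin (n + 1) → K)} (hq : q.rep 0 ≠ 0) :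
    q.rep = q.rep 0 • normRep q := by
  funext i
  simp [normRep, mul_div_cancel₀ _ hq]

theorem eval_rep_eq_zero_iff (hp0 : ∀ j, (p j).rep 0 ≠ 0) {F : MvPolynomial (Fin (n + 1)) K}
    {d : ℕ} (hF : F.IsHomogeneous d) (j : Fin s) :
    eval (p j).rep F = 0 ↔ eval (normRep (p j)) F = 0 := by
  rw [rep_eq_smul_normRep (hp0 j), eval_smul_of_isHomogeneous hF,
    mul_eq_zero_iff_left (pow_ne_zero _ (hp0 j))]

theorem normRep_injective (hp : Function.Injective p) (hp0 : ∀ j, (p j).rep 0 ≠ 0) :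
    Function.Injective fun j => normRep (p j) := by
  intro j k hjk
  apply hp
  rw [← (p j).mk_rep, ← (p k).mk_rep, Projectivization.mk_eq_mk_iff']
  refine ⟨(p j).rep 0 / (p k).rep 0, ?_⟩
  calc ((p j).rep 0 / (p k).rep 0) • (p k).rep
      = ((p j).rep 0 / (p k).rep 0) • (p k).rep 0 • normRep (p k) := by
        rw [← rep_eq_smul_normRep (hp0 k)]
    _ = (p j).rep 0 • normRep (p j) := by
        rw [smul_smul, div_mul_cancel₀ _ (hp0 k)]
        exact congrArg _ hjk.symm
    _ = (p j).rep := (rep_eq_smul_normRep (hp0 j)).symm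

theorem mem_vanishingIdeal_iff (hp0 : ∀ j, (p j).rep 0 ≠ 0) {F : MvPolynomial (Fin (n + 1)) K}
    {d : ℕ} (hF : F.IsHomogeneous d) :
    F ∈ vanishingIdeal p ↔ evalPoints (fun j => normRep (p j)) F = 0 := by
  constructor
  · intro h
    funext j
    rw [evalPoints_apply]
    exact (eval_rep_eq_zero_iff hp0 hF j).1 (eval_rep_eq_zero_of_mem p h j)
  · intro h
    refine Ideal.subset_span ⟨⟨d, hF⟩, fun j => (eval_rep_eq_zero_iff hp0 hF j).2 ?_⟩
    rw [← evalPoints_apply (fun j => normRep (p j)), h, Pi.zero_apply]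

/-- Both spaces are images of the forms of degree `d` under maps with the same kernel. -/
theorem hilbertFunction_eq_finrank_formValues (hp0 : ∀ j, (p j).rep 0 ≠ 0) (d : ℕ) :
    hilbertFunction p d = Module.finrank K (formValues (fun j => normRep (p j)) d) := by
  set f := (Ideal.Quotient.mkₐ K (vanishingIdeal p)).toLinearMap.domRestrict
    (homogeneousSubmodule (Fin (n + 1)) K d) with hf
  set g := (evalPoints fun j => normRep (p j)).domRestrict
    (homogeneousSubmodule (Fin (n + 1)) K d) with hg
  have hker : LinearMap.ker f = LinearMap.ker g := by
    ext F
    rw [LinearMap.mem_ker, LinearMap.mem_ker, hf, hg, LinearMap.domRestrict_apply,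
      LinearMap.domRestrict_apply, ← mem_vanishingIdeal_iff hp0 F.2]
    exact Ideal.Quotient.eq_zero_iff_mem
  rw [hilbertFunction, ringPart, formValues, ← LinearMap.range_domRestrict,
    ← LinearMap.range_domRestrict]
  exact (f.quotKerEquivRange.symm ≪≫ₗ Submodule.quotEquivOfEq _ _ hker ≪≫ₗ
    g.quotKerEquivRange).finrank_eq

/-- From the initial degree on the Hilbert function is `s`; one degree lower it is a binomial
coefficient smaller than `s`. -/
theorem regularityIndex_eq_initialDegree (hgen : IsInGenericPosition p)
    (hlow : (n + initialDegree p - 1).choose n < s) (hupp : s < (n + initialDegree p).choose n)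
    (hα : 1 ≤ initialDegree p) : regularityIndex p = initialDegree p := by
  have hHF (j : ℕ) (hj : initialDegree p ≤ j) : hilbertFunction p j = s := by
    rw [hgen j, min_eq_left]
    exact hupp.le.trans (Nat.choose_le_choose n (by omega))
  have hmem : initialDegree p ∈ {i : ℕ | ∃ q : Polynomial ℚ,
      ∀ j : ℕ, i ≤ j → (hilbertFunction p j : ℚ) = q.eval (j : ℚ)} :=
    ⟨Polynomial.C (s : ℚ), fun j hj => by rw [hHF j hj, Polynomial.eval_C]⟩
  refine le_antisymm (Nat.sInf_le hmem) ?_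
  by_contra! hlt
  obtain ⟨q, hq⟩ := Nat.sInf_mem ⟨_, hmem⟩
  change ∀ j, regularityIndex p ≤ j → _ at hq
  -- A polynomial equal to `s` at infinitely many integers is constant.
  have hconst : q = Polynomial.C (s : ℚ) := by
    refine Polynomial.eq_of_infinite_eval_eq _ _ (Set.Infinite.mono ?_
      ((Set.Ici_infinite (initialDegree p)).image (Nat.cast_injective (R := ℚ)).injOn))
    rintro _ ⟨j, hj, rfl⟩
    have hj' : initialDegree p ≤ j := hj
    change q.eval (j : ℚ) = _
    rw [← hq j (hlt.le.trans hj'), hHF j hj', Polynomial.eval_C]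
  have h := hq (initialDegree p - 1) (by omega)
  rw [hconst, Polynomial.eval_C, hgen, Nat.cast_inj,
    ← Nat.add_sub_assoc hα, min_eq_right hlow.le] at h
  omega

/-- The forms of degree `d` separate `p_j` from the other points if and only if the `j`-th standard
basis vector is among their vectors of values. -/
theorem pointDegree_le_iff (hp0 : ∀ j, (p j).rep 0 ≠ 0) {d e : ℕ}
    (he : formValues (fun j => normRep (p j)) e = ⊤) (j : Fin s) :
    pointDegree p j ≤ d ↔ Pi.single j 1 ∈ formValues (fun j => normRep (p j)) d := by
  have hP := normRep_zero hp0
  have hsep (i : ℕ) (hi : Pi.single j 1 ∈ formValues (fun j => normRep (p j)) i) :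
      ∃ f : MvPolynomial (Fin (n + 1)) K, f.IsHomogeneous i ∧ eval (p j).rep f ≠ 0 ∧
        ∀ k, k ≠ j → eval (p k).rep f = 0 := by
    obtain ⟨f, hf, hfe⟩ := hi
    refine ⟨f, hf, ?_, fun k hk => ?_⟩
    · rw [Ne, eval_rep_eq_zero_iff hp0 hf, ← evalPoints_apply (fun j => normRep (p j)), hfe]
      simp
    · rw [eval_rep_eq_zero_iff hp0 hf, ← evalPoints_apply (fun j => normRep (p j)), hfe]
      simp [hk]
  refine ⟨fun h => ?_, fun h => Nat.sInf_le (hsep d h)⟩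
  -- Degree `e` makes the set non-empty, so the infimum is attained rather than being the default
  -- `0`.
  obtain ⟨f, hf, hfj, hfk⟩ := Nat.sInf_mem (s := {i : ℕ | ∃ f : MvPolynomial (Fin (n + 1)) K,
    f.IsHomogeneous i ∧ eval (p j).rep f ≠ 0 ∧ ∀ k, k ≠ j → eval (p k).rep f = 0})
    ⟨e, hsep e (he ▸ Submodule.mem_top)⟩
  refine formValues_mono hP h ?_
  rw [Ne, eval_rep_eq_zero_iff hp0 hf] at hfj
  have : Pi.single j 1 = (eval (normRep (p j)) f)⁻¹ • evalPoints (fun j => normRep (p j)) f := by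
    funext k
    rw [Pi.smul_apply, evalPoints_apply, smul_eq_mul]
    by_cases hk : k = j
    · subst hk; simp [hfj]
    · rw [(eval_rep_eq_zero_iff hp0 hf k).1 (hfk k hk), Pi.single_eq_of_ne hk, mul_zero]
  rw [this]
  exact Submodule.smul_mem _ _ ⟨f, hf, rfl⟩

/-- The column space of the matrix of values. -/
theorem span_cols_valueMatrix {t : ℕ} (F : Fin t → MvPolynomial (Fin (n + 1)) K) :
    Submodule.span K (Set.range (valueMatrix p F).col) =
      (Submodule.span K (Set.range fun e : Fin n ↪o Fin t => jacobian (F ∘ e))).map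
        (evalPoints fun j => normRep (p j)) := by
  rw [Submodule.map_span, ← Set.range_comp]
  congr 2

theorem rank_lt_rank_augmentedMatrix_iff {t : ℕ} (F : Fin t → MvPolynomial (Fin (n + 1)) K)
    (j : Fin s) : (valueMatrix p F).rank < (augmentedMatrix p F j).rank ↔
      Pi.single j 1 ∉ Submodule.span K (Set.range (valueMatrix p F).col) := by
  have hcols : Set.range (augmentedMatrix p F j).col =
      Set.range (valueMatrix p F).col ∪ {Pi.single j 1} := by
    have : (augmentedMatrix p F j).col =
        Sum.elim (valueMatrix p F).col fun _ : Unit => Pi.single j 1 := by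
      funext x i
      rcases x with x | x <;> rfl
    rw [this, Set.Sum.elim_range, Set.range_const]
  rw [Matrix.rank_eq_finrank_span_cols, Matrix.rank_eq_finrank_span_cols, hcols,
    Submodule.span_union]
  constructor
  · intro h hmem
    rw [sup_eq_left.2 (Submodule.span_le.2 (Set.singleton_subset_iff.2 hmem))] at h
    exact lt_irrefl _ h
  · intro h
    refine Submodule.finrank_lt_finrank_of_lt (lt_of_le_of_ne le_sup_left fun heq => h ?_)
    rw [heq]
    exact Submodule.mem_sup_right (Submodule.mem_span_singleton_self _)

end Points

end KaehlerCB

theorem proposition3p7 {K : Type*} [Field K] (n s t : ℕ) (hn : 2 ≤ n)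
    (hchar : ringChar K = 0 ∨ s < ringChar K)
    (p : Fin s → ℙ K (Fin (n + 1) → K)) (hp : Function.Injective p)
    (hp0 : ∀ j, (p j).rep 0 ≠ 0)
    (hgen : KaehlerCB.IsInGenericPosition p)
    (hlow : (n + KaehlerCB.initialDegree p - 1).choose n < s)
    (hupp : s < (n + KaehlerCB.initialDegree p).choose n)
    (hr : 2 ≤ KaehlerCB.regularityIndex p) (ht : n ≤ t)
    (F : Fin t → MvPolynomial (Fin (n + 1)) K) (hFind : LinearIndependent K F)
    (hFspan : Submodule.span K (Set.range F) =
      KaehlerCB.idealPart p (KaehlerCB.initialDegree p)) :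
    Submodule.span K (Set.range fun e : Fin n ↪o Fin t =>
        Ideal.Quotient.mk (KaehlerCB.vanishingIdeal p) (KaehlerCB.jacobianMinor F e)) =
      KaehlerCB.kaehlerDifferentPart p (n * (KaehlerCB.regularityIndex p - 1)) ∧
    ((∀ j, (KaehlerCB.valueMatrix p F).rank < (KaehlerCB.augmentedMatrix p F j).rank) →
      KaehlerCB.IsCBScheme p) ∧
    ((n = 2 ∨ (n = 3 ∧ KaehlerCB.regularityIndex p = 2)) → KaehlerCB.IsCBScheme p →
      ∀ j, (KaehlerCB.valueMatrix p F).rank < (KaehlerCB.augmentedMatrix p F j).rank) := by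
  open KaehlerCB MvPolynomial in
  have hα : 1 ≤ initialDegree p := by
    -- Initial degree `0` would give `s < 1`, whereas `hlow` forces `s` to be positive.
    by_contra! h0
    have h0' : initialDegree p = 0 := by omega
    rw [h0', add_zero, Nat.choose_self] at hupp
    omega
  have hreg := regularityIndex_eq_initialDegree hgen hlow hupp hα
  rw [hreg] at hr ⊢
  have hP := normRep_zero hp0
  obtain ⟨d, hd⟩ : ∃ d, initialDegree p = d + 1 := ⟨initialDegree p - 1, by omega⟩
  have htop : formValues (fun j => normRep (p j)) (d + 1) = ⊤ := by
    apply Submodule.eq_top_of_finrank_eq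
    rw [← hilbertFunction_eq_finrank_formValues hp0, hgen, ← hd, min_eq_left hupp.le,
      Module.finrank_fin_fun]
  -- Every point has degree at most `d + 1` by `htop`, so equality means that degree `d` does not
  -- suffice.
  have hdeg (j : Fin s) : pointDegree p j = d + 1 ↔
      Pi.single j 1 ∉ formValues (fun j => normRep (p j)) d := by
    rw [← pointDegree_le_iff hp0 htop j]
    have := (pointDegree_le_iff hp0 htop j).2 (htop ▸ Submodule.mem_top)
    omega
  refine ⟨span_jacobianMinor_eq p hα F hFspan, fun h j => ?_, fun hnr hCB j => ?_⟩
  · rw [hreg, hd, hdeg]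
    rintro ⟨f, hf, hfe⟩
    have hfe' (k : Fin s) : eval (normRep (p k)) f = (Pi.single j 1 : Fin s → K) k := by
      rw [← hfe, evalPoints_apply]
    obtain ⟨v, hv, hv0, hvj, hvk⟩ := exists_jacobian_separator (P := fun j => normRep (p j)) hn hP
      j f hf (by simp [hfe']) fun k hk => by simp [hfe', hk]
    refine (rank_lt_rank_augmentedMatrix_iff F j).1 (h j) ?_
    have hmem := alternating_mem_span_orderEmb jacobian F v fun i => by
      rw [hFspan, hd]
      refine ⟨(mem_vanishingIdeal_iff hp0 (hv i)).2 (funext fun k => ?_), hv i⟩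
      rw [evalPoints_apply, hv0, Pi.zero_apply]
    rw [span_cols_valueMatrix]
    have : Pi.single j 1 = (eval (normRep (p j)) (jacobian v))⁻¹ •
        evalPoints (fun j => normRep (p j)) (jacobian v) := by
      funext k
      rw [Pi.smul_apply, evalPoints_apply, smul_eq_mul]
      by_cases hk : k = j
      · subst hk; simp [hvj]
      · rw [hvk k hk, Pi.single_eq_of_ne hk, mul_zero]
    rw [this]
    exact Submodule.smul_mem _ _ (Submodule.mem_map_of_mem hmem)
  · have hj := hCB j
    rw [hreg, hd, hdeg] at hj
    rw [rank_lt_rank_augmentedMatrix_iff, span_cols_valueMatrix]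
    intro hmem
    -- `φ` kills the values of the forms of degree `d` but not `E_j`.
    obtain ⟨φ, hφj, hφ⟩ := Submodule.exists_le_ker_of_notMem hj
    have hφsum (v : Fin s → K) : φ v = ∑ k, φ (Pi.single k 1) * v k := by
      conv_lhs => rw [← Finset.univ_sum_single v, map_sum]
      refine Finset.sum_congr rfl fun k _ => ?_
      have hk : (Pi.single k (v k) : Fin s → K) = v k • Pi.single k 1 := by
        rw [← Pi.single_smul, smul_eq_mul, mul_one]
      rw [hk, map_smul, smul_eq_mul, mul_comm]
    -- Multiplication by the coordinates of `φ` carries the column space into the values of forms of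
    -- degree `d`.
    have hle : (Submodule.span K (Set.range fun e : Fin n ↪o Fin t => jacobian (F ∘ e))).map
        (evalPoints fun j => normRep (p j)) ≤ (formValues (fun j => normRep (p j)) d).comap
          (LinearMap.mulLeft K fun k => φ (Pi.single k 1)) := by
      rw [Submodule.map_span, Submodule.span_le]
      rintro _ ⟨_, ⟨e, rfl⟩, rfl⟩
      have hF (i : Fin n) : F (e i) ∈ idealPart p (d + 1) :=
        hd ▸ hFspan ▸ Submodule.subset_span ⟨e i, rfl⟩
      refine mul_jacobian_mem_formValues (d := d) (c := d) hP (normRep_injective hp hp0) ?_ (F ∘ e)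
        (fun i => (hF i).2) (fun i k => ?_) _ fun v hv => ?_
      · rcases hnr with rfl | ⟨rfl, h2⟩ <;> omega
      · exact (eval_rep_eq_zero_iff hp0 (hF i).2 k).1 (eval_rep_eq_zero_of_mem p (hF i).1 k)
      · rw [← hφsum]
        exact hφ hv
    have h := hle hmem
    rw [Submodule.mem_comap, LinearMap.mulLeft_apply] at h
    have hmul : (fun k => φ (Pi.single k 1)) * Pi.single j 1 =
        φ (Pi.single j 1) • (Pi.single j 1 : Fin s → K) := by
      funext k
      by_cases hk : k = j
      · subst hk; simp
      · simp [hk]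
    rw [hmul] at h
    exact hj ((Submodule.smul_mem_iff _ hφj).1 h)
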